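/- **Setting.** Let $\mathcal X\subset\mathbb R^p$ and $\mathcal Y\subset\mathbb R$ be compact, and let $\mathcal H$ be a real reproducing kernel Hilbert space of measurable functions on $\mathcal X$ with kernel $\kappa$ such that $\sup_{x\in\mathcal X}\sqrt{\kappa(x,x)}<\infty$. Let $\ell:\mathbb R\times\mathcal Y\to\mathbb R$ be a loss that is measurable in its second argument and such that, for every $y\in\mathcal Y$, the map $z\mapsto\ell(z,y)$ is convex, differentiable (with derivative $\ell'(z,y)$) and $C$-Lipschitz, with $C$ not depending on $y$. Let $(x_t,y_t)_{t\ge 0}$ be i.i.d. with the law of a random pair $(x,y)\in\mathcal X\times\mathcal Y$ for which $\mathbb E|\ell(0,y)|<\infty$. For $\lambda>0$ put $R(f)=\mathbb E[\ell(f(x),y)]+\frac\lambda2\|f\|_{\mathcal H}^2$, and let $f^*\in\mathcal H$ be the minimizer of $R$ over $\mathcal H$. **Algorithm (POLK).** A dictionary is a finite list $D=[d_1,\dots,d_M]$ of observed feature vectors, and $\mathcal H_D=\operatorname{span}\{\kappa(d_n,\cdot)\}_{n\le M}$. Start from $f_0=0$ with the empty dictionary $D_0$. With step size $\eta>0$ and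 budget $\epsilon>0$, at time $t$ form $$\tilde f_{t+1}=(1-\eta\lambda)f_t-\eta\,\ell'(f_t(x_t),y_t)\,\kappa(x_t,\cdot)$$ with dictionary $\tilde D_{t+1}=[D_t,x_t]$ and the corresponding coefficients, and apply destructive kernel orthogonal matching pursuit to it: as long as the current dictionary $D$ is non-empty, find an element $d_j$ of $D$ whose removal error $\gamma_j=\min_{g\in\mathcal H_{D\setminus\{d_j\}}}\|\tilde f_{t+1}-g\|_{\mathcal H}$ is smallest; if $\gamma_j>\epsilon$, stop; otherwise remove $d_j$ from $D$, refit the coefficients by least squares to $\tilde f_{t+1}$, and repeat. The resulting dictionary and function are $D_{t+1}$ and $f_{t+1}$. Ties may be broken in any way that does not look at future samples: there is a filtration $(\mathcal F_t)$, the algorithm history before $(x_t,y_t)$ is drawn, such that $f_t$ and $(x_u,y_u)_{u<t}$ are $\mathcal F_t$-measurable and $(x_t,y_t)$ is independent of $\mathcal F_t$. Let $P_{t+1}$ be the orthogonal projection of $\mathcal H$ onto $\mathcal H_{D_{t+1}}$, and put $$\hat\nabla_t=\ell'(f_t(x_t),y_t)\,\kappa(x_t,\cdot)+\lambda f_t,\qquad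 \tilde\nabla_t=\frac1\eta\bigl(f_t-P_{t+1}[f_t-\eta\hat\nabla_t]\bigr).$$ Assume that $\mathbb E\bigl[\|\tilde\nabla_t\|_{\mathcal H}^2\mid\mathcal F_t\bigr]\le\sigma^2$ almost surely for every $t$. **Theorem.** Let $0<\eta<1/\lambda$ be constant, and let $\epsilon=K\eta^{3/2}$ with a constant $K>0$. Then, almost surely, $$\liminf_{t\to\infty}\|f_t-f^*\|_{\mathcal H}\le\frac{\sqrt\eta}{\lambda}\Bigl(K+\sqrt{K^2+\lambda\sigma^2}\Bigr),$$ and, for fixed $\lambda$, $K$ and $\sigma$, the right-hand side is $O(\sqrt\eta)$ as $\eta\to0^+$. -/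

import Mathlib

open MeasureTheory ProbabilityTheory Filter Topology Asymptotics

namespace POLK

noncomputable section

/- Throughout, `H` is a real reproducing kernel Hilbert space of functions `X → ℝ`; elements of `H`
are evaluated as functions, `f x`. -/

/-- The kernel section `κ(x, ·)`, an element of `H`. -/
def feature {X : Type*} (H : Type*) [NormedAddCommGroup H] [InnerProductSpace ℝ H]
    [CompleteSpace H] [RKHS ℝ H X ℝ] (x : X) : H :=
  RKHS.kerFun H x 1

/-- The scalar reproducing kernel `κ(x, x')` of `H`. -/
def kappa {X : Type*} (H : Type*) [NormedAddCommGroup H] [InnerProductSpace ℝ H]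
    [CompleteSpace H] [RKHS ℝ H X ℝ] (x x' : X) : ℝ :=
  RKHS.kernel H x x' 1

/-- The kernel expansion `∑_{k ∈ I} w_k κ(d_k, ·)`: the function with dictionary `(d_k)_{k ∈ I}`
and coefficients `(w_k)_{k ∈ I}`. Coefficients outside `I` are irrelevant. -/
def expansion {X ι : Type*} (H : Type*) [NormedAddCommGroup H] [InnerProductSpace ℝ H]
    [CompleteSpace H] [RKHS ℝ H X ℝ] (d : ι → X) (I : Finset ι) (w : ι → ℝ) : H :=
  ∑ k ∈ I, w k • feature H (d k)

/-- The subspace `span {κ(d_k, ·) : k ∈ I}` of `H` that belongs to a dictionary. -/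
def dictSpan {X ι : Type*} (H : Type*) [NormedAddCommGroup H] [InnerProductSpace ℝ H]
    [CompleteSpace H] [RKHS ℝ H X ℝ] (d : ι → X) (I : Finset ι) : Submodule ℝ H :=
  Submodule.span ℝ ((fun k => feature H (d k)) '' (I : Set ι))

instance instFiniteDimensionalDictSpan {X ι : Type*} (H : Type*) [NormedAddCommGroup H]
    [InnerProductSpace ℝ H] [CompleteSpace H] [RKHS ℝ H X ℝ] (d : ι → X) (I : Finset ι) :
    FiniteDimensional ℝ (dictSpan H d I) :=
  FiniteDimensional.span_of_finite ℝ (I.finite_toSet.image _)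

/-- The error `γ_j = min_w ‖f̃ - ∑_{k ∈ I \ {j}} w_k κ(d_k, ·)‖` of removing the dictionary
element `j`. -/
def removalError {X ι : Type*} [DecidableEq ι] {H : Type*} [NormedAddCommGroup H]
    [InnerProductSpace ℝ H] [CompleteSpace H] [RKHS ℝ H X ℝ] (d : ι → X) (ftil : H)
    (I : Finset ι) (j : ι) : ℝ :=
  ⨅ w : ι → ℝ, ‖ftil - expansion H d (I.erase j) w‖

/-- The states `(I, w)` that the loop of destructive kernel orthogonal matching pursuit can reach
from the input dictionary `(d_k)_{k ∈ Itil}` with coefficients `wtil` and budget `ε`. One pass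
removes an index with the smallest removal error, provided that this error is at most `ε`, and
then refits the coefficients to the input function by least squares. Ties may be broken in
any way. -/
inductive KOMPReaches {X ι : Type*} [DecidableEq ι] (H : Type*) [NormedAddCommGroup H]
    [InnerProductSpace ℝ H] [CompleteSpace H] [RKHS ℝ H X ℝ] (d : ι → X) (Itil : Finset ι)
    (wtil : ι → ℝ) (ε : ℝ) : Finset ι → (ι → ℝ) → Prop
  | init : KOMPReaches H d Itil wtil ε Itil wtil
  | prune {I : Finset ι} {w : ι → ℝ} (j : ι) (w' : ι → ℝ) :
      KOMPReaches H d Itil wtil ε I w →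
      j ∈ I →
      (∀ k ∈ I, removalError d (expansion H d Itil wtil) I j ≤
        removalError d (expansion H d Itil wtil) I k) →
      removalError d (expansion H d Itil wtil) I j ≤ ε →
      (∀ v : ι → ℝ, ‖expansion H d Itil wtil - expansion H d (I.erase j) w'‖ ≤
        ‖expansion H d Itil wtil - expansion H d (I.erase j) v‖) →
      KOMPReaches H d Itil wtil ε (I.erase j) w'

/-- `(I, w)` is an output of destructive KOMP: it is reached, and the loop stops there, because no
index is left or because the smallest removal error exceeds the budget. -/
def IsKOMPOutput {X ι : Type*} [DecidableEq ι] (H : Type*) [NormedAddCommGroup H]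
    [InnerProductSpace ℝ H] [CompleteSpace H] [RKHS ℝ H X ℝ] (d : ι → X) (Itil : Finset ι)
    (wtil : ι → ℝ) (ε : ℝ) (I : Finset ι) (w : ι → ℝ) : Prop :=
  KOMPReaches H d Itil wtil ε I w ∧
    ∀ j ∈ I, ε < removalError d (expansion H d Itil wtil) I j

/-- The derivative `ℓ'(z, y)` of the loss in its first, scalar argument. -/
def lossDeriv {Y : Type*} (ℓ : ℝ → Y → ℝ) (z : ℝ) (y : Y) : ℝ :=
  deriv (fun u => ℓ u y) z

/-- A run of POLK on the data `(x_t, y_t)`, with step sizes `η_t`, budgets `ε_t` and regularizer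
`lam`. A dictionary element is labelled by the time at which it was observed, so the dictionary at
time `t` is `(x_i)_{i ∈ I t}`, with coefficients `(w t i)_{i ∈ I t}`. Step `t` rescales the old
coefficients by `1 - η_t lam`, appends the label `t` with coefficient `-η_t ℓ'(f_t(x_t), y_t)`, and
applies KOMP with budget `ε_t`. -/
structure IsPOLKRun {X Y : Type*} (H : Type*) [NormedAddCommGroup H] [InnerProductSpace ℝ H]
    [CompleteSpace H] [RKHS ℝ H X ℝ] (ℓ : ℝ → Y → ℝ) (lam : ℝ) (η ε : ℕ → ℝ)
    (x : ℕ → X) (y : ℕ → Y) (I : ℕ → Finset ℕ) (w : ℕ → ℕ → ℝ) : Prop where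
  init : I 0 = ∅
  step : ∀ t : ℕ, IsKOMPOutput H x (insert t (I t))
    (fun i => if i = t then - η t * lossDeriv ℓ (expansion H x (I t) (w t) (x t)) (y t)
      else (1 - η t * lam) * w t i)
    (ε t) (I (t + 1)) (w (t + 1))

/-- The regularized stochastic gradient `ℓ'(f(x), y) κ(x, ·) + lam f` at the sample `(x, y)`. -/
def stochGrad {X Y : Type*} {H : Type*} [NormedAddCommGroup H] [InnerProductSpace ℝ H]
    [CompleteSpace H] [RKHS ℝ H X ℝ] (ℓ : ℝ → Y → ℝ) (lam : ℝ) (f : H) (x : X) (y : Y) : H :=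
  lossDeriv ℓ (f x) y • feature H x + lam • f

/-- The projected stochastic gradient `(f - P[f - η g]) / η`, where `g` is the regularized
stochastic gradient of `f` at `(x, y)` and `P` is the orthogonal projection onto the subspace of
the dictionary `(d_k)_{k ∈ I}`. -/
def projGrad {X Y ι : Type*} {H : Type*} [NormedAddCommGroup H] [InnerProductSpace ℝ H]
    [CompleteSpace H] [RKHS ℝ H X ℝ] (ℓ : ℝ → Y → ℝ) (lam η : ℝ) (d : ι → X) (I : Finset ι)
    (f : H) (x : X) (y : Y) : H :=
  η⁻¹ • (f - (dictSpan H d I).starProjection (f - η • stochGrad ℓ lam f x y))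

/-- The regularized expected risk `R(f) = E[ℓ(f(x), y)] + (lam / 2) ‖f‖²` for `(x, y)` with
law `P`. -/
def risk {X Y : Type*} [MeasurableSpace X] [MeasurableSpace Y] {H : Type*} [NormedAddCommGroup H]
    [InnerProductSpace ℝ H] [CompleteSpace H] [RKHS ℝ H X ℝ] (ℓ : ℝ → Y → ℝ) (lam : ℝ)
    (P : Measure (X × Y)) (f : H) : ℝ :=
  (∫ q, ℓ (f q.1) q.2 ∂P) + lam / 2 * ‖f‖ ^ 2

end

end POLK

/-!
Convexity of the loss and strong convexity of the risk turn the step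
`f_{t+1} = f_t - η g_t + (error of norm at most ε)` into the conditional drift inequality
`E[‖f_{t+1} - f*‖² | F_t] ≤ (1 - 2 η lam) ‖f_t - f*‖² + 2 ε ‖f_t - f*‖ + η² σ²`.
Above the positive root of `η lam d² = 2 ε d + η² σ²` the squared distance therefore loses a fixed
amount in conditional mean. A nonnegative process cannot do so forever, so almost surely the
distance returns below every level above that root infinitely often.
-/

namespace POLK

section Hilbert

variable {E : Type*} [NormedAddCommGroup E] [InnerProductSpace ℝ E]

lemma sub_le_deriv_mul_sub {s : Set ℝ} {φ : ℝ → ℝ} {φ' x y : ℝ} (hφ : ConvexOn ℝ s φ)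
    (hx : x ∈ s) (hy : y ∈ s) (hφ' : HasDerivAt φ φ' x) : φ x - φ y ≤ φ' * (x - y) := by
  rcases lt_trichotomy x y with hlt | rfl | hgt
  · have hslope := hφ.le_slope_of_hasDerivAt hx hy hlt hφ'
    rw [slope_def_field, le_div_iff₀ (sub_pos.2 hlt)] at hslope
    linarith
  · simp
  · have hslope := hφ.slope_le_of_hasDerivAt hy hx hgt hφ'
    rw [slope_def_field, div_le_iff₀ (sub_pos.2 hgt)] at hslope
    linarith

lemma half_mul_sq_norm_sub_le_of_isMinOn {s : Set E} {m : ℝ} {φ : E → ℝ} {g f : E}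
    (hφ : StrongConvexOn s m φ) (hg : g ∈ s) (hf : f ∈ s) (hmin : IsMinOn φ s g) :
    m / 2 * ‖f - g‖ ^ 2 ≤ φ f - φ g := by
  have hseg : ∀ a ∈ Set.Ioo (0 : ℝ) 1, (1 - a) * (m / 2 * ‖f - g‖ ^ 2) ≤ φ f - φ g := by
    rintro a ⟨ha₀, ha₁⟩
    have hconv := hφ.2 hf hg ha₀.le (sub_nonneg.2 ha₁.le) (add_sub_cancel a 1)
    have hle : φ g ≤ φ (a • f + (1 - a) • g) :=
      hmin (hφ.1 hf hg ha₀.le (sub_nonneg.2 ha₁.le) (add_sub_cancel a 1))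
    simp only [smul_eq_mul] at hconv
    refine le_of_mul_le_mul_left ?_ ha₀
    linarith
  have hlim : Tendsto (fun a : ℝ => (1 - a) * (m / 2 * ‖f - g‖ ^ 2)) (𝓝[>] 0)
      (𝓝 (m / 2 * ‖f - g‖ ^ 2)) :=
    (Continuous.tendsto' (by fun_prop) _ _ (by simp)).mono_left nhdsWithin_le_nhds
  exact le_of_tendsto hlim (eventually_of_mem (Ioo_mem_nhdsGT one_pos) hseg)

lemma norm_sub_sq_le_of_approx_step {f f' g v : E} {η ε : ℝ} (h : ‖f - η • v - f'‖ ≤ ε) :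
    ‖f' - g‖ ^ 2 ≤ ‖f - g‖ ^ 2 - 2 * η * inner ℝ (f - g) v + 2 * ε * ‖f - g‖ + ‖f - f'‖ ^ 2 := by
  have hexpand := norm_sub_sq_real (f - g) (f - f')
  rw [sub_sub_sub_cancel_left] at hexpand
  have hsplit : inner ℝ (f - g) (f - f') =
      η * inner ℝ (f - g) v + inner ℝ (f - g) (f - η • v - f') := by
    rw [← inner_smul_right, ← inner_add_right]
    congr 1
    abel
  have herror : -(‖f - g‖ * ε) ≤ inner ℝ (f - g) (f - η • v - f') :=
    (neg_le_neg (mul_le_mul_of_nonneg_left h (norm_nonneg _))).trans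
      (neg_le_of_abs_le (abs_real_inner_le_norm _ _))
  linarith

end Hilbert

section Probability

variable {Ω : Type*} {mΩ : MeasurableSpace Ω} {μ : Measure Ω}

lemma memLp_of_norm_succ_le [IsFiniteMeasure μ] {E : Type*} [NormedAddCommGroup E]
    {p : ENNReal} {f : ℕ → Ω → E} {a b : ℝ} (hf : ∀ t, AEStronglyMeasurable (f t) μ)
    (h0 : MemLp (f 0) p μ) (hsucc : ∀ t ω, ‖f (t + 1) ω‖ ≤ a * ‖f t ω‖ + b) (t : ℕ) :
    MemLp (f t) p μ := by
  induction t with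
  | zero => exact h0
  | succ t ih =>
    exact ((ih.norm.const_mul a).add (memLp_const b)).mono' (hf _) (ae_of_all _ (hsucc t))

lemma condExp_comp_prodMk_of_indepFun [IsFiniteMeasure μ] {T Q : Type*} [mT : MeasurableSpace T]
    [MeasurableSpace Q] {u : Ω → T} {q : Ω → Q} {P : Measure Q} (hu : Measurable u)
    (hq : HasLaw q P μ) (hindep : IndepFun u q μ) {ψ : T × Q → ℝ} (hψ : StronglyMeasurable ψ)
    (hint : Integrable (fun ω => ψ (u ω, q ω)) μ) :
    μ[fun ω => ψ (u ω, q ω) | mT.comap u] =ᵐ[μ] fun ω => ∫ z, ψ (u ω, z) ∂P := by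
  have hlaw : μ.map (fun ω => (u ω, q ω)) = (μ.map u).prod P := by
    rw [(indepFun_iff_map_prod_eq_prod_map_map hu.aemeasurable hq.aemeasurable).1 hindep,
      hq.map_eq]
  have hP : IsFiniteMeasure P := hq.isFiniteMeasure_iff.1 ‹_›
  have huq : AEMeasurable (fun ω => (u ω, q ω)) μ := hu.aemeasurable.prodMk hq.aemeasurable
  have hψint : Integrable ψ ((μ.map u).prod P) := by
    rw [← hlaw]
    exact (integrable_map_measure hψ.aestronglyMeasurable huq).2 hint
  have hmean : StronglyMeasurable fun s => ∫ z, ψ (s, z) ∂P := hψ.integral_prod_right'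
  refine (ae_eq_condExp_of_forall_setIntegral_eq hu.comap_le hint (fun _ _ _ => ?_) ?_
    (hmean.comp_measurable (comap_measurable u)).aestronglyMeasurable).symm
  · exact ((integrable_map_measure hmean.aestronglyMeasurable hu.aemeasurable).1
      hψint.integral_prod_left).integrableOn
  · rintro _ ⟨s, hs, rfl⟩ -
    calc ∫ ω in u ⁻¹' s, (∫ z, ψ (u ω, z) ∂P) ∂μ
        = ∫ t in s, (∫ z in Set.univ, ψ (t, z) ∂P) ∂(μ.map u) := by
          simp only [Measure.restrict_univ]
          rw [setIntegral_map hs hmean.aestronglyMeasurable hu.aemeasurable]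
      _ = ∫ z in s ×ˢ Set.univ, ψ z ∂(μ.map fun ω => (u ω, q ω)) := by
          rw [hlaw, setIntegral_prod _ hψint.integrableOn]
      _ = ∫ ω in u ⁻¹' s, ψ (u ω, q ω) ∂μ := by
          rw [setIntegral_map (hs.prod .univ) hψ.aestronglyMeasurable huq, Set.prod_univ]
          rfl

lemma condExp_comp_prodMk_of_indep [IsFiniteMeasure μ] {Q : Type*} [mQ : MeasurableSpace Q]
    {m : MeasurableSpace Ω} (hm : m ≤ mΩ) {q : Ω → Q} {P : Measure Q} (hq : HasLaw q P μ)
    (hindep : Indep (mQ.comap q) m μ) {ψ : Ω × Q → ℝ} (hψ : StronglyMeasurable[m.prod mQ] ψ)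
    (hint : Integrable (fun ω => ψ (ω, q ω)) μ) :
    μ[fun ω => ψ (ω, q ω) | m] =ᵐ[μ] fun ω => ∫ z, ψ (ω, z) ∂P := by
  have hid : @IndepFun Ω Ω Q mΩ m mQ id q μ := by
    rw [IndepFun_iff_Indep, MeasurableSpace.comap_id]
    exact hindep.symm
  simpa only [MeasurableSpace.comap_id, id_eq] using
    condExp_comp_prodMk_of_indepFun (mT := m) (u := id) (measurable_id'' hm) hq hid hψ hint

lemma setIntegral_le_of_condExp_le_on [IsFiniteMeasure μ] {m : MeasurableSpace Ω} (hm : m ≤ mΩ)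
    {A : Set Ω} (hA : MeasurableSet[m] A) {u v : Ω → ℝ} (hu : Integrable u μ) (hv : Integrable v μ)
    (h : ∀ᵐ ω ∂μ, ω ∈ A → μ[u | m] ω ≤ v ω) : ∫ ω in A, u ω ∂μ ≤ ∫ ω in A, v ω ∂μ := by
  rw [← setIntegral_condExp hm hu hA]
  exact setIntegral_mono_on_ae integrable_condExp.integrableOn hv.integrableOn (hm _ hA) h

end Probability

section Drift

variable {Ω : Type*} {mΩ : MeasurableSpace Ω} {μ : Measure Ω} [IsFiniteMeasure μ]
  {𝓕 : Filtration ℕ mΩ}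

lemma setIntegral_add_le_of_drift {V : ℕ → Ω → ℝ} {c : ℝ} {T : ℕ} {A : ℕ → Set Ω} {B : Set Ω}
    (hV₀ : ∀ t ω, 0 ≤ V t ω) (hint : ∀ t, Integrable (V t) μ) (hc : 0 ≤ c)
    (hA_meas : ∀ n, MeasurableSet[𝓕 (T + n)] (A (n + 1))) (hA_anti : Antitone A)
    (hB : ∀ n, B ⊆ A n)
    (hdrift : ∀ n, ∀ᵐ ω ∂μ, ω ∈ A (n + 1) →
      μ[V (T + n + 1) | 𝓕 (T + n)] ω ≤ V (T + n) ω - c) (n : ℕ) :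
    ∫ ω in A n, V (T + n) ω ∂μ + n * (c * μ.real B) ≤ ∫ ω, V T ω ∂μ := by
  induction n with
  | zero =>
    simpa using setIntegral_le_integral (s := A 0) (hint T) (ae_of_all _ (hV₀ T))
  | succ n ih =>
    have hstep : ∫ ω in A (n + 1), V (T + n + 1) ω ∂μ ≤ ∫ ω in A (n + 1), (V (T + n) ω - c) ∂μ :=
      setIntegral_le_of_condExp_le_on (𝓕.le _) (hA_meas n) (hint _)
        ((hint _).sub (integrable_const c)) (hdrift n)
    rw [integral_sub (hint _).integrableOn (integrable_const c), setIntegral_const,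
      smul_eq_mul] at hstep
    have hmono : ∫ ω in A (n + 1), V (T + n) ω ∂μ ≤ ∫ ω in A n, V (T + n) ω ∂μ :=
      setIntegral_mono_set (hint _).integrableOn (ae_of_all _ (hV₀ _))
        (hA_anti n.le_succ).eventuallyLE
    have hprob : c * μ.real B ≤ c * μ.real (A (n + 1)) :=
      mul_le_mul_of_nonneg_left (measureReal_mono (hB _)) hc
    rw [← add_assoc T n 1]
    push_cast
    linarith

lemma ae_exists_le_of_drift {V : ℕ → Ω → ℝ} {a c : ℝ} (hV₀ : ∀ t ω, 0 ≤ V t ω)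
    (hadapted : StronglyAdapted 𝓕 V) (hint : ∀ t, Integrable (V t) μ) (hc : 0 < c)
    (hdrift : ∀ t, ∀ᵐ ω ∂μ, a < V t ω → μ[V (t + 1) | 𝓕 t] ω ≤ V t ω - c) (T : ℕ) :
    ∀ᵐ ω ∂μ, ∃ t ≥ T, V t ω ≤ a := by
  set A : ℕ → Set Ω := fun n => {ω | ∀ k < n, a < V (T + k) ω}
  set B : Set Ω := {ω | ¬∃ t ≥ T, V t ω ≤ a}
  have hA_meas : ∀ n, MeasurableSet[𝓕 (T + n)] (A (n + 1)) := fun n => by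
    simp only [A, Set.ofPred_forall]
    refine MeasurableSet.iInter fun k => MeasurableSet.iInter fun hk => ?_
    exact 𝓕.mono (by omega) _ ((hadapted (T + k)).measurable measurableSet_Ioi)
  have hB : ∀ n, B ⊆ A n := fun n ω hω k _ => by
    by_contra! hle
    exact hω ⟨T + k, T.le_add_right k, hle⟩
  have hbound : ∀ n : ℕ, n * (c * μ.real B) ≤ ∫ ω, V T ω ∂μ := fun n =>
    (le_add_of_nonneg_left (integral_nonneg (hV₀ _))).trans <|
      setIntegral_add_le_of_drift hV₀ hint hc.le hA_meas
        (fun i j hij ω hω k hk => hω k (hk.trans_le hij)) hB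
        (fun k => (hdrift (T + k)).mono fun ω h hω => h (hω k k.lt_succ_self)) n
  have hB_null : μ.real B = 0 := by
    by_contra hne
    have hpos : 0 < c * μ.real B := mul_pos hc (measureReal_nonneg.lt_of_ne' hne)
    obtain ⟨n, hn⟩ := exists_nat_gt ((∫ ω, V T ω ∂μ) / (c * μ.real B))
    exact ((div_lt_iff₀ hpos).1 hn).not_ge (hbound n)
  exact (measureReal_eq_zero_iff).1 hB_null

lemma ae_frequently_le_of_drift {V : ℕ → Ω → ℝ} {a c : ℝ} (hV₀ : ∀ t ω, 0 ≤ V t ω)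
    (hadapted : StronglyAdapted 𝓕 V) (hint : ∀ t, Integrable (V t) μ) (hc : 0 < c)
    (hdrift : ∀ t, ∀ᵐ ω ∂μ, a < V t ω → μ[V (t + 1) | 𝓕 t] ω ≤ V t ω - c) :
    ∀ᵐ ω ∂μ, ∃ᶠ t in atTop, V t ω ≤ a := by
  simp only [frequently_atTop]
  exact ae_all_iff.2 (ae_exists_le_of_drift hV₀ hadapted hint hc hdrift)

lemma two_mul_add_le_of_root_le {a ε S d : ℝ} (ha : 0 < a)
    (hd : (ε + √(ε ^ 2 + a * S)) / a ≤ d) : 2 * ε * d + S ≤ a * d ^ 2 := by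
  rw [div_le_iff₀ ha, ← le_sub_iff_add_le'] at hd
  have hsq := (Real.sqrt_le_iff.1 hd).2
  refine le_of_mul_le_mul_left ?_ ha
  linarith

lemma ae_liminf_le_of_drift {d : ℕ → Ω → ℝ} {a ε S : ℝ} (hd₀ : ∀ t ω, 0 ≤ d t ω)
    (hadapted : StronglyAdapted 𝓕 d) (hint : ∀ t, MemLp (d t) 2 μ) (ha : 0 < a) (hε : 0 ≤ ε)
    (hdrift : ∀ t, μ[fun ω => d (t + 1) ω ^ 2 | 𝓕 t] ≤ᵐ[μ]
      fun ω => (1 - 2 * a) * d t ω ^ 2 + 2 * ε * d t ω + S) :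
    ∀ᵐ ω ∂μ, liminf (fun t => (d t ω : EReal)) atTop ≤
      (((ε + √(ε ^ 2 + a * S)) / a : ℝ) : EReal) := by
  set r := (ε + √(ε ^ 2 + a * S)) / a
  have hr : 0 ≤ r := by positivity
  have hfreq : ∀ b > r, ∀ᵐ ω ∂μ, ∃ᶠ t in atTop, d t ω ^ 2 ≤ b ^ 2 := fun b hb => by
    have hb₀ : 0 < b := hr.trans_lt hb
    refine ae_frequently_le_of_drift (V := fun t ω => d t ω ^ 2) (𝓕 := 𝓕) (c := a * b ^ 2)
      (fun t ω => sq_nonneg _) (fun t => (hadapted t).pow 2) (fun t => (hint t).integrable_sq)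
      (by positivity) fun t => ?_
    filter_upwards [hdrift t] with ω hω hlt
    have hbd : b < d t ω := lt_of_pow_lt_pow_left₀ 2 (hd₀ t ω) hlt
    have hquad := two_mul_add_le_of_root_le ha (hb.trans hbd).le
    have hgain := mul_le_mul_of_nonneg_left hlt.le ha.le
    linarith
  obtain ⟨b, -, hb, hblim⟩ := exists_seq_strictAnti_tendsto r
  filter_upwards [ae_all_iff.2 fun n => hfreq (b n) (hb n)] with ω hω
  refine ge_of_tendsto' ((continuous_coe_real_ereal.tendsto r).comp hblim) fun n => ?_
  refine liminf_le_of_frequently_le' ((hω n).mono fun t ht => ?_)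
  exact EReal.coe_le_coe_iff.2 (le_of_sq_le_sq ht (hr.trans (hb n).le))

end Drift

section Step

variable {Ω : Type*} {mΩ : MeasurableSpace Ω} {μ : Measure Ω} [IsFiniteMeasure μ]
  {m : MeasurableSpace Ω} {E : Type*} [NormedAddCommGroup E] [InnerProductSpace ℝ E]

lemma condExp_norm_sub_sq_le_of_approx_step (hm : m ≤ mΩ) {F F' v : Ω → E} {D : Ω → ℝ} {g : E}
    {η ε lam S : ℝ} (hF : StronglyMeasurable[m] F) (hF₂ : MemLp F 2 μ) (hF'₂ : MemLp F' 2 μ)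
    (hD : Integrable D μ) (hη : 0 ≤ η) (hstep : ∀ ω, ‖F ω - η • v ω - F' ω‖ ≤ ε)
    (hDv : ∀ ω, D ω + lam / 2 * ‖F ω - g‖ ^ 2 ≤ inner ℝ (F ω - g) (v ω))
    (hgrowth : ∀ᵐ ω ∂μ, lam / 2 * ‖F ω - g‖ ^ 2 ≤ μ[D | m] ω)
    (hS : μ[fun ω => ‖F ω - F' ω‖ ^ 2 | m] ≤ᵐ[μ] fun _ => S) :
    μ[fun ω => ‖F' ω - g‖ ^ 2 | m] ≤ᵐ[μ]
      fun ω => (1 - 2 * (η * lam)) * ‖F ω - g‖ ^ 2 + 2 * ε * ‖F ω - g‖ + S := by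
  set W : Ω → ℝ := fun ω => (1 - η * lam) * ‖F ω - g‖ ^ 2 + 2 * ε * ‖F ω - g‖
  set N : Ω → ℝ := fun ω => ‖F ω - F' ω‖ ^ 2
  have hdist : MemLp (fun ω => F ω - g) 2 μ := hF₂.sub (memLp_const g)
  have hW : Integrable W μ := (hdist.norm.integrable_sq.const_mul _).add
    ((hdist.norm.integrable one_le_two).const_mul _)
  have hWm : StronglyMeasurable[m] W := by
    have hn : StronglyMeasurable[m] fun ω => ‖F ω - g‖ := (hF.sub stronglyMeasurable_const).norm
    exact ((hn.pow 2).const_mul _).add (hn.const_mul _)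
  have hN : Integrable N μ := (hF₂.sub hF'₂).norm.integrable_sq
  have hpointwise : ∀ ω, ‖F' ω - g‖ ^ 2 ≤ (W - (2 * η) • D + N) ω := fun ω => by
    have h₁ := norm_sub_sq_le_of_approx_step (g := g) (hstep ω)
    have h₂ := mul_le_mul_of_nonneg_left (hDv ω) hη
    simp only [W, N, Pi.add_apply, Pi.sub_apply, Pi.smul_apply, smul_eq_mul]
    linarith
  have hDi : Integrable ((2 * η) • D) μ := hD.smul _
  have hF'g : Integrable (fun ω => ‖F' ω - g‖ ^ 2) μ :=
    (hF'₂.sub (memLp_const g)).norm.integrable_sq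
  filter_upwards [condExp_mono (m := m) hF'g ((hW.sub hDi).add hN) (ae_of_all _ hpointwise),
    condExp_add (hW.sub hDi) hN m, condExp_sub hW hDi m, condExp_smul (2 * η) D m, hgrowth,
    hS] with ω hmono hadd hsub hsmul hD hS
  rw [hadd, Pi.add_apply, hsub, Pi.sub_apply, hsmul, Pi.smul_apply, smul_eq_mul,
    condExp_of_stronglyMeasurable hm hWm hW] at hmono
  have hgain := mul_le_mul_of_nonneg_left hD hη
  simp only [W] at hmono
  linarith

end Step

section Kernel

variable {X : Type*} {H : Type*} [NormedAddCommGroup H] [InnerProductSpace ℝ H]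
  [CompleteSpace H] [RKHS ℝ H X ℝ]

lemma inner_feature (h : H) (x : X) : inner ℝ h (feature H x) = h x := by
  simp only [feature, RKHS.inner_kerFun, RCLike.inner_apply, conj_trivial, one_mul]

lemma sqrt_kappa_eq_norm_feature (x : X) : √(kappa H x x) = ‖feature H x‖ := by
  have hκ : kappa H x x = ‖feature H x‖ ^ 2 := by
    rw [← real_inner_self_eq_norm_sq, inner_feature, feature, RKHS.kerFun_apply, kappa]
  rw [hκ, Real.sqrt_sq (norm_nonneg _)]

lemma exists_norm_feature_le (hκ : BddAbove (Set.range fun x : X => √(kappa H x x))) :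
    ∃ B, ∀ x : X, ‖feature H x‖ ≤ B := by
  obtain ⟨B, hB⟩ := hκ
  exact ⟨B, fun x => (sqrt_kappa_eq_norm_feature (H := H) x).ge.trans (hB ⟨x, rfl⟩)⟩

lemma abs_apply_le {B : ℝ} (hB : ∀ x : X, ‖feature H x‖ ≤ B) (h : H) (x : X) :
    |h x| ≤ B * ‖h‖ := by
  rw [← inner_feature, mul_comm]
  exact (abs_real_inner_le_norm _ _).trans (mul_le_mul_of_nonneg_left (hB x) (norm_nonneg h))

variable {ι : Type*} {d : ι → X}

lemma mem_dictSpan_iff {I : Finset ι} {h : H} :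
    h ∈ dictSpan H d I ↔ ∃ v : ι → ℝ, expansion H d I v = h :=
  Submodule.mem_span_image_finset_iff_exists_fun' ℝ

lemma expansion_eq_starProjection {I : Finset ι} {u : H} {w : ι → ℝ}
    (hw : ∀ v : ι → ℝ, ‖u - expansion H d I w‖ ≤ ‖u - expansion H d I v‖) :
    expansion H d I w = (dictSpan H d I).starProjection u := by
  have hmem : expansion H d I w ∈ dictSpan H d I := mem_dictSpan_iff.2 ⟨w, rfl⟩
  have hmin : ‖u - expansion H d I w‖ = ⨅ h : dictSpan H d I, ‖u - h‖ := by
    refine le_antisymm (le_ciInf fun ⟨h, hh⟩ => ?_)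
      (ciInf_le ⟨0, by rintro _ ⟨h, rfl⟩; exact norm_nonneg _⟩ (⟨_, hmem⟩ : dictSpan H d I))
    obtain ⟨v, rfl⟩ := mem_dictSpan_iff.1 hh
    exact hw v
  exact (Submodule.eq_starProjection_of_mem_of_inner_eq_zero hmem
    ((Submodule.norm_eq_iInf_iff_real_inner_eq_zero _ hmem).1 hmin)).symm

variable [DecidableEq ι] {Itil I : Finset ι} {wtil w : ι → ℝ} {ε : ℝ}

lemma KOMPReaches.subset (h : KOMPReaches H d Itil wtil ε I w) : I ⊆ Itil := by
  induction h with
  | init => exact subset_rfl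
  | prune _ _ _ _ _ _ _ ih => exact (Finset.erase_subset _ _).trans ih

lemma KOMPReaches.eq_starProjection (h : KOMPReaches H d Itil wtil ε I w) :
    expansion H d I w = (dictSpan H d I).starProjection (expansion H d Itil wtil) := by
  cases h with
  | init => exact (Submodule.starProjection_eq_self_iff.2 (mem_dictSpan_iff.2 ⟨_, rfl⟩)).symm
  | prune _ _ _ _ _ _ hmin => exact expansion_eq_starProjection hmin

lemma KOMPReaches.norm_sub_le (hε : 0 ≤ ε) (h : KOMPReaches H d Itil wtil ε I w) :
    ‖expansion H d Itil wtil - expansion H d I w‖ ≤ ε := by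
  cases h with
  | init => simpa only [sub_self, norm_zero] using hε
  | prune _ _ _ _ _ hle hmin => exact (le_ciInf hmin).trans hle

end Kernel

section Run

variable {X Y : Type*} {H : Type*} [NormedAddCommGroup H] [InnerProductSpace ℝ H]
  [CompleteSpace H] [RKHS ℝ H X ℝ] {ℓ : ℝ → Y → ℝ} {lam : ℝ} {η ε : ℕ → ℝ}
  {x : ℕ → X} {y : ℕ → Y} {I : ℕ → Finset ℕ} {w : ℕ → ℕ → ℝ}

lemma IsPOLKRun.subset_range (h : IsPOLKRun H ℓ lam η ε x y I w) (t : ℕ) :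
    I t ⊆ Finset.range t := by
  induction t with
  | zero => exact h.init.le
  | succ t ih =>
    rw [Finset.range_add_one]
    exact (h.step t).1.subset.trans (Finset.insert_subset_insert _ ih)

lemma IsPOLKRun.expansion_insert (h : IsPOLKRun H ℓ lam η ε x y I w) (t : ℕ) :
    expansion H x (insert t (I t))
      (fun i => if i = t then - η t * lossDeriv ℓ (expansion H x (I t) (w t) (x t)) (y t)
        else (1 - η t * lam) * w t i) =
    expansion H x (I t) (w t) -
      η t • stochGrad ℓ lam (expansion H x (I t) (w t)) (x t) (y t) := by
  have ht : t ∉ I t := fun hmem => (Finset.mem_range.1 (h.subset_range t hmem)).false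
  rw [stochGrad]
  generalize lossDeriv ℓ (expansion H x (I t) (w t) (x t)) (y t) = c
  have hold : ∑ i ∈ I t, (if i = t then - η t * c else (1 - η t * lam) * w t i) • feature H (x i)
      = (1 - η t * lam) • expansion H x (I t) (w t) := by
    rw [expansion, Finset.smul_sum]
    refine Finset.sum_congr rfl fun i hi => ?_
    rw [if_neg (ne_of_mem_of_not_mem hi ht), mul_smul]
  conv_lhs => rw [expansion, Finset.sum_insert ht, hold, if_pos rfl]
  module

lemma IsPOLKRun.expansion_succ_eq (h : IsPOLKRun H ℓ lam η ε x y I w) (t : ℕ) :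
    expansion H x (I (t + 1)) (w (t + 1)) = (dictSpan H x (I (t + 1))).starProjection
      (expansion H x (I t) (w t) -
        η t • stochGrad ℓ lam (expansion H x (I t) (w t)) (x t) (y t)) := by
  rw [← h.expansion_insert]
  exact (h.step t).1.eq_starProjection

lemma IsPOLKRun.norm_sub_expansion_succ_le (h : IsPOLKRun H ℓ lam η ε x y I w) (t : ℕ)
    (hε : 0 ≤ ε t) :
    ‖expansion H x (I t) (w t) - η t • stochGrad ℓ lam (expansion H x (I t) (w t)) (x t) (y t)
      - expansion H x (I (t + 1)) (w (t + 1))‖ ≤ ε t := by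
  rw [← h.expansion_insert]
  exact (h.step t).1.norm_sub_le hε

lemma IsPOLKRun.smul_projGrad_eq (h : IsPOLKRun H ℓ lam η ε x y I w) {t : ℕ} (hη : η t ≠ 0) :
    η t • projGrad ℓ lam (η t) x (I (t + 1)) (expansion H x (I t) (w t)) (x t) (y t) =
      expansion H x (I t) (w t) - expansion H x (I (t + 1)) (w (t + 1)) := by
  rw [projGrad, ← h.expansion_succ_eq, smul_inv_smul₀ hη]

lemma norm_sub_smul_stochGrad_le {B C s : ℝ} (hC₀ : 0 ≤ C) (hC : ∀ z y, |lossDeriv ℓ z y| ≤ C)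
    (hB : ∀ x : X, ‖feature H x‖ ≤ B) (f : H) (x : X) (y : Y) :
    ‖f - s • stochGrad ℓ lam f x y‖ ≤ |1 - s * lam| * ‖f‖ + |s| * (C * B) := by
  have hstep : f - s • stochGrad ℓ lam f x y =
      (1 - s * lam) • f - s • lossDeriv ℓ (f x) y • feature H x := by
    rw [stochGrad]
    module
  rw [hstep]
  refine (norm_sub_le _ _).trans ?_
  simp only [norm_smul, Real.norm_eq_abs]
  gcongr
  · exact hC _ _
  · exact hB x

lemma IsPOLKRun.norm_expansion_succ_le (h : IsPOLKRun H ℓ lam η ε x y I w) {B C : ℝ}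
    (hC₀ : 0 ≤ C) (hC : ∀ z y, |lossDeriv ℓ z y| ≤ C) (hB : ∀ x : X, ‖feature H x‖ ≤ B) (t : ℕ) :
    ‖expansion H x (I (t + 1)) (w (t + 1))‖ ≤
      |1 - η t * lam| * ‖expansion H x (I t) (w t)‖ + |η t| * (C * B) := by
  rw [h.expansion_succ_eq]
  exact (Submodule.norm_starProjection_apply_le _ _).trans
    (norm_sub_smul_stochGrad_le hC₀ hC hB ..)

lemma memLp_expansion_of_isPOLKRun {Ω : Type*} {mΩ : MeasurableSpace Ω} {μ : Measure Ω}
    [IsFiniteMeasure μ] {s : ℝ} {x : ℕ → Ω → X} {y : ℕ → Ω → Y} {I : ℕ → Ω → Finset ℕ}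
    {w : ℕ → Ω → ℕ → ℝ}
    (h : ∀ ω, IsPOLKRun H ℓ lam (fun _ => s) ε (x · ω) (y · ω) (I · ω) (w · ω)) {B C : ℝ}
    (hC₀ : 0 ≤ C) (hC : ∀ z y, |lossDeriv ℓ z y| ≤ C) (hB : ∀ x : X, ‖feature H x‖ ≤ B)
    (hmeas : ∀ t, AEStronglyMeasurable (fun ω => expansion H (x · ω) (I t ω) (w t ω)) μ)
    {p : ENNReal} (t : ℕ) : MemLp (fun ω => expansion H (x · ω) (I t ω) (w t ω)) p μ := by
  have hinit : ∀ ω, expansion H (x · ω) (I 0 ω) (w 0 ω) = 0 := fun ω => by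
    rw [expansion, (h ω).init, Finset.sum_empty]
  refine memLp_of_norm_succ_le (f := fun t ω => expansion H (x · ω) (I t ω) (w t ω)) hmeas ?_
    (fun t ω => (h ω).norm_expansion_succ_le hC₀ hC hB t) t
  simpa only [hinit] using memLp_const 0

end Run

section Loss

variable {X Y : Type*} {H : Type*} [NormedAddCommGroup H] [InnerProductSpace ℝ H]
  [RKHS ℝ H X ℝ] {ℓ : ℝ → Y → ℝ} {lam : ℝ}

/-- The regularized loss `ℓ(h(x), y) + (lam / 2) ‖h‖²` at the sample `z = (x, y)`: its mean over the
sample is the regularized risk, and `stochGrad` is its gradient in `h`. -/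
noncomputable def regLoss (ℓ : ℝ → Y → ℝ) (lam : ℝ) (h : H) (z : X × Y) : ℝ :=
  ℓ (h z.1) z.2 + lam / 2 * ‖h‖ ^ 2

lemma abs_lossDeriv_le {C : ℝ} (hC : 0 ≤ C) {y : Y}
    (hlip : ∀ z z' : ℝ, |ℓ z y - ℓ z' y| ≤ C * |z - z'|) (z : ℝ) : |lossDeriv ℓ z y| ≤ C := by
  rw [lossDeriv, ← Real.norm_eq_abs]
  exact norm_deriv_le_of_lip' hC (Eventually.of_forall fun u => hlip u z)

lemma regLoss_sub_add_le_inner_stochGrad [CompleteSpace H]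
    (hconv : ∀ y : Y, ConvexOn ℝ Set.univ (fun z => ℓ z y))
    (hdiff : ∀ y : Y, Differentiable ℝ (fun z => ℓ z y)) (f g : H) (z : X × Y) :
    regLoss ℓ lam f z - regLoss ℓ lam g z + lam / 2 * ‖f - g‖ ^ 2 ≤
      inner ℝ (f - g) (stochGrad ℓ lam f z.1 z.2) := by
  have htangent : ℓ (f z.1) z.2 - ℓ (g z.1) z.2 ≤ lossDeriv ℓ (f z.1) z.2 * (f z.1 - g z.1) :=
    sub_le_deriv_mul_sub (hconv z.2) (Set.mem_univ _) (Set.mem_univ _)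
      (hdiff z.2 (f z.1)).hasDerivAt
  have hpolarization : inner ℝ (f - g) f = (‖f‖ ^ 2 - ‖g‖ ^ 2 + ‖f - g‖ ^ 2) / 2 := by
    rw [norm_sub_sq_real, inner_sub_left, real_inner_self_eq_norm_sq, real_inner_comm]
    ring
  rw [stochGrad, inner_add_right, inner_smul_right, inner_smul_right, inner_feature,
    hpolarization, RKHS.coe_sub, Pi.sub_apply, regLoss, regLoss]
  linarith

end Loss

section Risk

variable {X Y : Type*} [MeasurableSpace X] [MeasurableSpace Y] {H : Type*} [NormedAddCommGroup H]
  [InnerProductSpace ℝ H] [RKHS ℝ H X ℝ] {ℓ : ℝ → Y → ℝ} {lam : ℝ} {P : Measure (X × Y)}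

lemma measurable_uncurry_apply {S : Type*} [MeasurableSpace S] {F : S → H}
    (hH : ∀ h : H, Measurable (fun x : X => h x)) (hF : StronglyMeasurable F) :
    Measurable fun z : S × X => F z.1 z.2 := by
  refine measurable_of_tendsto_metrizable (f := fun n (z : S × X) => hF.approx n z.1 z.2)
    (fun n => ?_) (tendsto_pi_nhds.2 fun z => ?_)
  · exact ((hF.approx n).comp Prod.fst measurable_fst).measurable_bind (fun h z => h z.2)
      fun h => (hH h).comp measurable_snd
  · exact ((RKHS.continuous_eval z.2).tendsto _).comp (hF.tendsto_approx z.1)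

lemma stronglyMeasurable_loss {S : Type*} [MeasurableSpace S] {F : S → H}
    (hH : ∀ h : H, Measurable (fun x : X => h x)) (hmeas : ∀ z : ℝ, Measurable (ℓ z))
    (hcont : ∀ y : Y, Continuous (fun z => ℓ z y)) (hF : StronglyMeasurable F) :
    StronglyMeasurable fun z : S × X × Y => ℓ (F z.1 z.2.1) z.2.2 :=
  ((measurable_uncurry_of_continuous_of_measurable hcont hmeas).comp
    (((measurable_uncurry_apply hH hF).comp
      (measurable_fst.prodMk (measurable_fst.comp measurable_snd))).prodMk
      (measurable_snd.comp measurable_snd))).stronglyMeasurable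

variable [CompleteSpace H] {B C : ℝ} {Ω : Type*} {mΩ : MeasurableSpace Ω} {μ : Measure Ω}
  {q : Ω → X × Y} {F : Ω → H}

lemma integrable_loss (hH : ∀ h : H, Measurable (fun x : X => h x))
    (hB : ∀ x : X, ‖feature H x‖ ≤ B) (hC : 0 ≤ C) (hmeas : ∀ z : ℝ, Measurable (ℓ z))
    (hlip : ∀ (y : Y) (z z' : ℝ), |ℓ z y - ℓ z' y| ≤ C * |z - z'|)
    (hcont : ∀ y : Y, Continuous (fun z => ℓ z y))
    (hint : Integrable (fun z : X × Y => ℓ 0 z.2) P) (hq : HasLaw q P μ)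
    (hF : StronglyMeasurable F) (hFint : Integrable F μ) :
    Integrable (fun ω => ℓ (F ω (q ω).1) (q ω).2) μ := by
  have hq₀ : Integrable (fun ω => ℓ 0 (q ω).2) μ := by
    rw [← hq.map_eq] at hint
    exact hint.comp_aemeasurable hq.aemeasurable
  have hloss : AEStronglyMeasurable (fun ω => ℓ (F ω (q ω).1) (q ω).2) μ :=
    ((stronglyMeasurable_loss hH hmeas hcont hF).measurable.comp_aemeasurable
      (aemeasurable_id.prodMk hq.aemeasurable)).aestronglyMeasurable
  refine (hq₀.norm.add (hFint.norm.const_mul (C * B))).mono' hloss (ae_of_all _ fun ω => ?_)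
  have hdev : |ℓ (F ω (q ω).1) (q ω).2 - ℓ 0 (q ω).2| ≤ C * B * ‖F ω‖ :=
    calc _ ≤ C * |F ω (q ω).1| := by simpa only [sub_zero] using hlip (q ω).2 (F ω (q ω).1) 0
      _ ≤ C * B * ‖F ω‖ := by
        rw [mul_assoc]
        exact mul_le_mul_of_nonneg_left (abs_apply_le hB _ _) hC
  have htri := abs_sub_abs_le_abs_sub (ℓ (F ω (q ω).1) (q ω).2) (ℓ 0 (q ω).2)
  simp only [Pi.add_apply, Real.norm_eq_abs]
  linarith

lemma strongConvexOn_risk (hconv : ∀ y : Y, ConvexOn ℝ Set.univ (fun z => ℓ z y))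
    (hint : ∀ h : H, Integrable (fun z : X × Y => ℓ (h z.1) z.2) P) :
    StrongConvexOn Set.univ lam (risk (H := H) ℓ lam P) := by
  simp only [strongConvexOn_iff_convex, risk, add_sub_cancel_right]
  refine ⟨convex_univ, fun f _ g _ a b ha hb hab => ?_⟩
  simp only [smul_eq_mul]
  rw [← integral_const_mul, ← integral_const_mul,
    ← integral_add ((hint f).const_mul a) ((hint g).const_mul b)]
  refine integral_mono (hint _) (((hint f).const_mul a).add ((hint g).const_mul b)) fun z => ?_
  simpa only [RKHS.coe_add, RKHS.coe_smul, Pi.add_apply, Pi.smul_apply, smul_eq_mul] using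
    (hconv z.2).2 (Set.mem_univ (f z.1)) (Set.mem_univ (g z.1)) ha hb hab

lemma half_mul_sq_norm_sub_le_risk_sub (hconv : ∀ y : Y, ConvexOn ℝ Set.univ (fun z => ℓ z y))
    (hint : ∀ h : H, Integrable (fun z : X × Y => ℓ (h z.1) z.2) P) {g : H}
    (hg : ∀ h : H, risk ℓ lam P g ≤ risk ℓ lam P h) (h : H) :
    lam / 2 * ‖h - g‖ ^ 2 ≤ risk ℓ lam P h - risk ℓ lam P g :=
  half_mul_sq_norm_sub_le_of_isMinOn (strongConvexOn_risk hconv hint) (Set.mem_univ g)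
    (Set.mem_univ h) fun h _ => hg h

lemma condExp_regLoss [IsFiniteMeasure μ] {m : MeasurableSpace Ω} (hm : m ≤ mΩ)
    (hH : ∀ h : H, Measurable (fun x : X => h x)) (hmeas : ∀ z : ℝ, Measurable (ℓ z))
    (hcont : ∀ y : Y, Continuous (fun z => ℓ z y)) (hq : HasLaw q P μ)
    (hindep : Indep (MeasurableSpace.comap q inferInstance) m μ) (hF : StronglyMeasurable[m] F)
    (hF₂ : MemLp F 2 μ) (hint : Integrable (fun ω => ℓ (F ω (q ω).1) (q ω).2) μ) :
    μ[fun ω => regLoss ℓ lam (F ω) (q ω) | m] =ᵐ[μ] fun ω => risk ℓ lam P (F ω) := by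
  have hreg : Integrable (fun ω => lam / 2 * ‖F ω‖ ^ 2) μ := hF₂.norm.integrable_sq.const_mul _
  have hreg_meas : StronglyMeasurable[m] fun ω => lam / 2 * ‖F ω‖ ^ 2 :=
    (hF.norm.pow 2).const_mul _
  filter_upwards [condExp_add hint hreg m, condExp_comp_prodMk_of_indep hm hq hindep
    (stronglyMeasurable_loss hH hmeas hcont hF) hint]
    with ω hadd hloss
  refine hadd.trans ?_
  rw [Pi.add_apply, hloss, condExp_of_stronglyMeasurable hm hreg_meas hreg, risk]

lemma condExp_norm_sub_sq_le_of_stochGrad_step [IsFiniteMeasure μ] {m : MeasurableSpace Ω}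
    (hm : m ≤ mΩ) (hH : ∀ h : H, Measurable (fun x : X => h x))
    (hmeas : ∀ z : ℝ, Measurable (ℓ z)) (hconv : ∀ y : Y, ConvexOn ℝ Set.univ (fun z => ℓ z y))
    (hdiff : ∀ y : Y, Differentiable ℝ (fun z => ℓ z y))
    (hint : ∀ G : Ω → H, StronglyMeasurable[mΩ] G → MemLp G 2 μ →
      Integrable (fun ω => ℓ (G ω (q ω).1) (q ω).2) μ)
    (hq : HasLaw q P μ) (hindep : Indep (MeasurableSpace.comap q inferInstance) m μ)
    {F' : Ω → H} (hF : StronglyMeasurable[m] F) (hF₂ : MemLp F 2 μ) (hF'₂ : MemLp F' 2 μ)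
    {η ε S : ℝ} (hη : 0 ≤ η)
    (hstep : ∀ ω, ‖F ω - η • stochGrad ℓ lam (F ω) (q ω).1 (q ω).2 - F' ω‖ ≤ ε)
    (hS : μ[fun ω => ‖F ω - F' ω‖ ^ 2 | m] ≤ᵐ[μ] fun _ => S) {g : H}
    (hg : ∀ h : H, lam / 2 * ‖h - g‖ ^ 2 ≤ risk ℓ lam P h - risk ℓ lam P g) :
    μ[fun ω => ‖F' ω - g‖ ^ 2 | m] ≤ᵐ[μ]
      fun ω => (1 - 2 * (η * lam)) * ‖F ω - g‖ ^ 2 + 2 * ε * ‖F ω - g‖ + S := by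
  have hcont : ∀ y : Y, Continuous (fun z => ℓ z y) := fun y => (hdiff y).continuous
  have hlossF := hint F (hF.mono hm) hF₂
  have hlossg := hint (fun _ => g) stronglyMeasurable_const (memLp_const g)
  have hregF : Integrable (fun ω => regLoss ℓ lam (F ω) (q ω)) μ :=
    hlossF.add (hF₂.norm.integrable_sq.const_mul _)
  have hregg : Integrable (fun ω => regLoss ℓ lam g (q ω)) μ := hlossg.add (integrable_const _)
  refine condExp_norm_sub_sq_le_of_approx_step hm hF hF₂ hF'₂ (hregF.sub hregg) hη hstep
    (fun ω => regLoss_sub_add_le_inner_stochGrad hconv hdiff (F ω) g (q ω)) ?_ hS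
  filter_upwards [condExp_sub hregF hregg m,
    condExp_regLoss (lam := lam) hm hH hmeas hcont hq hindep hF hF₂ hlossF,
    condExp_regLoss (lam := lam) hm hH hmeas hcont hq hindep stronglyMeasurable_const
      (memLp_const g) hlossg] with ω hsub hmeanF hmeang
  rw [hsub, Pi.sub_apply, hmeanF, hmeang]
  exact hg (F ω)

end Risk

lemma condExp_sq_norm_smul_le {Ω E : Type*} {m mΩ : MeasurableSpace Ω} {μ : Measure Ω}
    [NormedAddCommGroup E] [NormedSpace ℝ E] {G : Ω → E} {S : ℝ}
    (hG : μ[fun ω => ‖G ω‖ ^ 2 | m] ≤ᵐ[μ] fun _ => S) (c : ℝ) :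
    μ[fun ω => ‖c • G ω‖ ^ 2 | m] ≤ᵐ[μ] fun _ => c ^ 2 * S := by
  have hscale : (fun ω => ‖c • G ω‖ ^ 2) = c ^ 2 • fun ω => ‖G ω‖ ^ 2 := by
    ext ω
    rw [norm_smul, mul_pow, Real.norm_eq_abs, sq_abs, Pi.smul_apply, smul_eq_mul]
  rw [hscale]
  filter_upwards [condExp_smul (μ := μ) (c ^ 2) (fun ω => ‖G ω‖ ^ 2) m, hG] with ω hsmul hle
  rw [hsmul, Pi.smul_apply, smul_eq_mul]
  exact mul_le_mul_of_nonneg_left hle (sq_nonneg c)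

lemma drift_root_eq {η lam K σ : ℝ} (hη : 0 < η) :
    (K * η ^ (3 / 2 : ℝ) + √((K * η ^ (3 / 2 : ℝ)) ^ 2 + η * lam * (η ^ 2 * σ ^ 2))) / (η * lam) =
      √η / lam * (K + √(K ^ 2 + lam * σ ^ 2)) := by
  have hpow : η ^ (3 / 2 : ℝ) = η * √η := by
    rw [show (3 / 2 : ℝ) = 1 + 1 / 2 by norm_num, Real.rpow_add hη, Real.rpow_one,
      ← Real.sqrt_eq_rpow]
  have hfactor : (K * (η * √η)) ^ 2 + η * lam * (η ^ 2 * σ ^ 2) =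
      (η * √η) ^ 2 * (K ^ 2 + lam * σ ^ 2) := by
    simp only [mul_pow, Real.sq_sqrt hη.le]
    ring
  rw [hpow, hfactor, Real.sqrt_mul (sq_nonneg _), Real.sqrt_sq (by positivity)]
  field_simp

end POLK

theorem theorem2_general
    {X Y : Type*} [MeasurableSpace X] [MeasurableSpace Y]
    {H : Type*} [NormedAddCommGroup H] [InnerProductSpace ℝ H] [CompleteSpace H] [RKHS ℝ H X ℝ]
    (hH_meas : ∀ h : H, Measurable (fun x : X => h x))
    (hκ : BddAbove (Set.range fun x : X => √(POLK.kappa H x x)))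
    (ℓ : ℝ → Y → ℝ)
    (hℓ_meas : ∀ z : ℝ, Measurable (ℓ z))
    (C : ℝ) (hℓ_lip : ∀ (y : Y) (z z' : ℝ), |ℓ z y - ℓ z' y| ≤ C * |z - z'|)
    (hℓ_conv : ∀ y : Y, ConvexOn ℝ Set.univ (fun z => ℓ z y))
    (hℓ_diff : ∀ y : Y, Differentiable ℝ (fun z => ℓ z y))
    {Ω : Type*} {mΩ : MeasurableSpace Ω} (μ : Measure Ω) [IsProbabilityMeasure μ]
    (P : Measure (X × Y))
    (hℓ_int : Integrable (fun q : X × Y => ℓ 0 q.2) P)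
    (x : ℕ → Ω → X) (y : ℕ → Ω → Y) (I : ℕ → Ω → Finset ℕ) (w : ℕ → Ω → ℕ → ℝ)
    (f : ℕ → Ω → H)
    (hf : ∀ t ω, f t ω = POLK.expansion H (fun i => x i ω) (I t ω) (w t ω))
    (𝓕 : Filtration ℕ mΩ)
    (hf_meas : ∀ t, StronglyMeasurable[𝓕 t] (f t))
    (hlaw : ∀ t, HasLaw (fun ω => (x t ω, y t ω)) P μ)
    (hindep : ∀ t, Indep
      (MeasurableSpace.comap (fun ω => (x t ω, y t ω)) inferInstance) (𝓕 t) μ)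
    (lam η K σ : ℝ) (hlam : 0 < lam) (hη : 0 < η) (hK : 0 ≤ K)
    (hrun : ∀ ω, POLK.IsPOLKRun H ℓ lam (fun _ => η) (fun _ => K * η ^ (3 / 2 : ℝ))
      (fun t => x t ω) (fun t => y t ω) (fun t => I t ω) (fun t => w t ω))
    (hσ : ∀ t, μ[fun ω => ‖POLK.projGrad ℓ lam η (fun i => x i ω) (I (t + 1) ω)
      (f t ω) (x t ω) (y t ω)‖ ^ 2 | 𝓕 t] ≤ᵐ[μ] fun _ => σ ^ 2)
    (fstar : H) (hfstar : ∀ g : H, POLK.risk ℓ lam P fstar ≤ POLK.risk ℓ lam P g) :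
    (∀ᵐ ω ∂μ, liminf (fun t => ((‖f t ω - fstar‖ : ℝ) : EReal)) atTop ≤
      ((√η / lam * (K + √(K ^ 2 + lam * σ ^ 2)) : ℝ) : EReal)) ∧
    (fun s : ℝ => √s / lam * (K + √(K ^ 2 + lam * σ ^ 2))) =O[𝓝[>] 0] (fun s : ℝ => √s) := by
  obtain ⟨ω₀⟩ : Nonempty Ω := nonempty_of_isProbabilityMeasure μ
  obtain ⟨B, hB⟩ := POLK.exists_norm_feature_le hκ
  have hC : 0 ≤ C := by simpa using (abs_nonneg _).trans (hℓ_lip (y 0 ω₀) 1 0)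
  have hcont : ∀ y : Y, Continuous (fun z => ℓ z y) := fun y => (hℓ_diff y).continuous
  have hε : 0 ≤ K * η ^ (3 / 2 : ℝ) := by positivity
  have hf₂ : ∀ t, MemLp (f t) 2 μ := fun t => by
    simpa only [← hf] using POLK.memLp_expansion_of_isPOLKRun hrun hC
      (fun z y => POLK.abs_lossDeriv_le hC (hℓ_lip y) z) hB
      (fun t => by simpa only [← hf] using ((hf_meas t).mono (𝓕.le t)).aestronglyMeasurable) t
  have hloss : ∀ t (G : Ω → H), StronglyMeasurable G → MemLp G 2 μ →
      Integrable (fun ω => ℓ (G ω (x t ω)) (y t ω)) μ := fun t G hG hG₂ =>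
    POLK.integrable_loss hH_meas hB hC hℓ_meas hℓ_lip hcont hℓ_int (hlaw t) hG
      (hG₂.integrable one_le_two)
  have hmoment : ∀ t, μ[fun ω => ‖f t ω - f (t + 1) ω‖ ^ 2 | 𝓕 t] ≤ᵐ[μ] fun _ => η ^ 2 * σ ^ 2 :=
    fun t => by
      simpa only [hf, fun ω => (hrun ω).smul_projGrad_eq (t := t) hη.ne'] using
        POLK.condExp_sq_norm_smul_le (hσ t) η
  have hstep : ∀ t ω, ‖f t ω - η • POLK.stochGrad ℓ lam (f t ω) (x t ω) (y t ω) - f (t + 1) ω‖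
      ≤ K * η ^ (3 / 2 : ℝ) := fun t ω => by
    simpa only [hf] using (hrun ω).norm_sub_expansion_succ_le t hε
  have : IsProbabilityMeasure P := (hlaw 0).isProbabilityMeasure_iff.1 ‹_›
  have hgrowth := POLK.half_mul_sq_norm_sub_le_risk_sub (lam := lam) hℓ_conv (fun h =>
    POLK.integrable_loss hH_meas hB hC hℓ_meas hℓ_lip hcont hℓ_int HasLaw.id
      stronglyMeasurable_const (integrable_const h)) hfstar
  have hdrift := fun t => POLK.condExp_norm_sub_sq_le_of_stochGrad_step (𝓕.le t) hH_meas hℓ_meas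
    hℓ_conv hℓ_diff (hloss t) (hlaw t) (hindep t) (hf_meas t) (hf₂ t) (hf₂ (t + 1)) hη.le
    (hstep t) (hmoment t) hgrowth
  constructor
  · rw [← POLK.drift_root_eq hη]
    exact POLK.ae_liminf_le_of_drift (fun _ _ => norm_nonneg _)
      (fun t => ((hf_meas t).sub stronglyMeasurable_const).norm)
      (fun t => ((hf₂ t).sub (memLp_const fstar)).norm) (mul_pos hη hlam) hε hdrift
  · simpa only [div_mul_eq_mul_div, mul_div_assoc, mul_comm] using
      isBigO_const_mul_self ((K + √(K ^ 2 + lam * σ ^ 2)) / lam) (fun s : ℝ => √s) (𝓝[>] 0)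

theorem theorem2
    {p : ℕ} {𝒳 : Set (EuclideanSpace ℝ (Fin p))} {𝒴 : Set ℝ}
    (h𝒳 : IsCompact 𝒳) (h𝒴 : IsCompact 𝒴)
    {H : Type*} [NormedAddCommGroup H] [InnerProductSpace ℝ H] [CompleteSpace H]
    [RKHS ℝ H 𝒳 ℝ]
    (hH_meas : ∀ h : H, Measurable (fun x : 𝒳 => h x))
    (hκ : BddAbove (Set.range fun x : 𝒳 => √(POLK.kappa H x x)))
    (ℓ : ℝ → 𝒴 → ℝ)
    (hℓ_meas : ∀ z : ℝ, Measurable (ℓ z))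
    (C : ℝ) (hℓ_lip : ∀ (y : 𝒴) (z z' : ℝ), |ℓ z y - ℓ z' y| ≤ C * |z - z'|)
    (hℓ_conv : ∀ y : 𝒴, ConvexOn ℝ Set.univ (fun z => ℓ z y))
    (hℓ_diff : ∀ y : 𝒴, Differentiable ℝ (fun z => ℓ z y))
    {Ω : Type*} {mΩ : MeasurableSpace Ω} (μ : Measure Ω) [IsProbabilityMeasure μ]
    (P : Measure (𝒳 × 𝒴))
    (hℓ_int : Integrable (fun q : 𝒳 × 𝒴 => ℓ 0 q.2) P)
    (x : ℕ → Ω → 𝒳) (y : ℕ → Ω → 𝒴) (I : ℕ → Ω → Finset ℕ) (w : ℕ → Ω → ℕ → ℝ)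
    (f : ℕ → Ω → H)
    (hf : ∀ t ω, f t ω = POLK.expansion H (fun i => x i ω) (I t ω) (w t ω))
    -- `𝓕 t` is the algorithm history before the sample `(x t, y t)` is drawn
    (𝓕 : Filtration ℕ mΩ)
    (hx_meas : ∀ t, Measurable[𝓕 (t + 1)] (x t))
    (hy_meas : ∀ t, Measurable[𝓕 (t + 1)] (y t))
    (hf_meas : ∀ t, StronglyMeasurable[𝓕 t] (f t))
    (hlaw : ∀ t, HasLaw (fun ω => (x t ω, y t ω)) P μ)
    (hindep : ∀ t, Indep
      (MeasurableSpace.comap (fun ω => (x t ω, y t ω)) inferInstance) (𝓕 t) μ)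
    (lam η K σ : ℝ) (hlam : 0 < lam) (hη : 0 < η) (hη_lt : η < 1 / lam) (hK : 0 < K)
    (hrun : ∀ ω, POLK.IsPOLKRun H ℓ lam (fun _ => η) (fun _ => K * η ^ (3 / 2 : ℝ))
      (fun t => x t ω) (fun t => y t ω) (fun t => I t ω) (fun t => w t ω))
    (hσ : ∀ t, μ[fun ω => ‖POLK.projGrad ℓ lam η (fun i => x i ω) (I (t + 1) ω)
      (f t ω) (x t ω) (y t ω)‖ ^ 2 | 𝓕 t] ≤ᵐ[μ] fun _ => σ ^ 2)
    (fstar : H) (hfstar : ∀ g : H, POLK.risk ℓ lam P fstar ≤ POLK.risk ℓ lam P g) :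
    (∀ᵐ ω ∂μ, liminf (fun t => ((‖f t ω - fstar‖ : ℝ) : EReal)) atTop ≤
      ((√η / lam * (K + √(K ^ 2 + lam * σ ^ 2)) : ℝ) : EReal)) ∧
    (fun s : ℝ => √s / lam * (K + √(K ^ 2 + lam * σ ^ 2))) =O[𝓝[>] 0] (fun s : ℝ => √s) :=
  theorem2_general hH_meas hκ ℓ hℓ_meas C hℓ_lip hℓ_conv hℓ_diff μ P hℓ_int x y I w f hf 𝓕 hf_meas
    hlaw hindep lam η K σ hlam hη hK.le hrun hσ fstar hfstar
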